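/- Let $0<q<1$ and $r\ge 1$, and for a positive integer $k$ put $[k]=\frac{1-q^k}{1-q}$. Let $U_r$ be the set of $(s_1,\dots,s_r)\in\mathbb C^r$ with $\operatorname{Re}(s_1+\dots+s_j)>0$ for $1\le j\le r$. The series $$\zeta_q(s_1,\dots,s_r)=\sum_{k_1>\dots>k_r\ge 1}\frac{q^{k_1s_1+\dots+k_rs_r}}{[k_1]^{s_1}\cdots[k_r]^{s_r}}$$ converges absolutely on $U_r$, and the function $\zeta_q$ (the Schlesinger–Zudilin $q$-multiple zeta function of depth $r$) has a meromorphic continuation to $\mathbb C^r$. For every meromorphic continuation, the set of its poles (the points at which it is not holomorphic, indeterminacy points included) is exactly $$\Big\{(s_1,\dots,s_r)\in\mathbb C^r:\ s_1+\dots+s_j\in\mathbb Z_{\le 0}+\tfrac{2\pi i}{\log q}\mathbb Z\ \text{ for some } 1\le j\le r\Big\},$$ and all poles are simple, in the following sense. For $p\in\mathbb C^r$ let $J(p)$ be the set of $j\in\{1,\dots,r\}$ with $p_1+\dots+p_j\in\mathbb Z_{\le 0}+\frac{2\pi i}{\log q}\mathbb Z$, and let $\ell_j(s)=(s_1+\dots+s_j)-(p_1+\dots+p_j)$.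 Then $\zeta_q\prod_{j\in J(p)}\ell_j$ is holomorphic at $p$, while for every $i\in J(p)$ the function $\zeta_q\prod_{j\in J(p)\setminus\{i\}}\ell_j$ is not holomorphic at $p$; that is, the pole along each of the hyperplanes has order exactly one. -/

import Mathlib

open Filter Topology

noncomputable section

/-- The `q`-analogue `[k]_q = (1 - q^k) / (1 - q)` of the natural number `k`. -/
def qNumber (q : ℝ) (k : ℕ) : ℝ := (1 - q ^ k) / (1 - q)

/-- Index set of the series: strictly decreasing tuples `k_1 > ⋯ > k_r ≥ 1`. -/
abbrev DecreasingTuple (r : ℕ) : Type := {k : Fin r → ℕ // StrictAnti k ∧ ∀ i, 1 ≤ k i}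

/-- Partial sums `s_1 + ⋯ + s_j` (with `j : Fin r`, counted from zero, so index `j` is included). -/
def partialSum {r : ℕ} (s : Fin r → ℂ) (j : Fin r) : ℂ := ∑ i ∈ Finset.Iic j, s i

/-- The domain `U_r`: all `s` with `Re (s_1 + ⋯ + s_j) > 0` for each `j`. -/
def convergenceDomain (r : ℕ) : Set (Fin r → ℂ) := {s | ∀ j, 0 < (partialSum s j).re}

/-- The general term `q^(k_1 s_1 + ⋯ + k_r s_r) / ([k_1]^{s_1} ⋯ [k_r]^{s_r})`. -/
def qZetaTerm (q : ℝ) {r : ℕ} (s : Fin r → ℂ) (k : DecreasingTuple r) : ℂ :=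
  (q : ℂ) ^ (∑ i, (k.1 i : ℂ) * s i) / ∏ i, ((qNumber q (k.1 i) : ℝ) : ℂ) ^ s i

/-- The series defining the `q`-multiple zeta function (SZ model) of depth `r`. -/
def qZetaSeries (q : ℝ) {r : ℕ} (s : Fin r → ℂ) : ℂ := ∑' k : DecreasingTuple r, qZetaTerm q s k

/-- `F` is, near `p`, a quotient of two holomorphic functions with a denominator that does not
vanish identically near `p`. The values of `F` where the denominator vanishes are irrelevant. -/
def IsMeromorphicAt {r : ℕ} (F : (Fin r → ℂ) → ℂ) (p : Fin r → ℂ) : Prop :=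
  ∃ g h : (Fin r → ℂ) → ℂ, AnalyticAt ℂ g p ∧ AnalyticAt ℂ h p ∧ (¬ ∀ᶠ z in 𝓝 p, h z = 0) ∧
    ∀ᶠ z in 𝓝 p, h z ≠ 0 → F z = g z / h z

/-- The meromorphic function represented by `F` is holomorphic at `p`: near `p`, and off the zero
set of a holomorphic function that does not vanish identically near `p`, `F` agrees with a
function holomorphic at `p`. -/
def IsRegularAt {r : ℕ} (F : (Fin r → ℂ) → ℂ) (p : Fin r → ℂ) : Prop :=
  ∃ φ h : (Fin r → ℂ) → ℂ, AnalyticAt ℂ φ p ∧ AnalyticAt ℂ h p ∧ (¬ ∀ᶠ z in 𝓝 p, h z = 0) ∧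
    ∀ᶠ z in 𝓝 p, h z ≠ 0 → F z = φ z

/-- `p` belongs to the polar set of the meromorphic function represented by `F`. -/
def IsPoleAt {r : ℕ} (F : (Fin r → ℂ) → ℂ) (p : Fin r → ℂ) : Prop :=
  IsMeromorphicAt F p ∧ ¬ IsRegularAt F p

/-- `F` represents a meromorphic continuation to `ℂ^r` of the `q`-multiple zeta function. -/
structure IsQZetaContinuation (q : ℝ) {r : ℕ} (F : (Fin r → ℂ) → ℂ) : Prop where
  meromorphic : ∀ p, IsMeromorphicAt F p
  eq_series : ∀ s ∈ convergenceDomain r, F s = qZetaSeries q s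

/-- The set `ℤ_{≤ 0} + (2πi / log q) ℤ`. -/
def polarLattice (q : ℝ) : Set ℂ :=
  {w | ∃ (a : ℕ) (b : ℤ), w = -(a : ℂ) + 2 * Real.pi * Complex.I / (Real.log q : ℂ) * (b : ℂ)}

open Classical in
/-- The indices `j` for which `p` lies on one of the hyperplanes `s_1 + ⋯ + s_j = c`,
`c ∈ ℤ_{≤ 0} + (2πi / log q) ℤ`. -/
def polarIndices (q : ℝ) {r : ℕ} (p : Fin r → ℂ) : Finset (Fin r) :=
  Finset.univ.filter fun j => partialSum p j ∈ polarLattice q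

/-- The poles of `F` at `p` are simple, and located along the hyperplanes
`s_1 + ⋯ + s_j = p_1 + ⋯ + p_j`, `j ∈ J`: near `p`, multiplication by one linear factor for
each of them makes `F` holomorphic, and none of the factors can be omitted. -/
def HasSimplePolesAlong {r : ℕ} (F : (Fin r → ℂ) → ℂ) (p : Fin r → ℂ) (J : Finset (Fin r)) :
    Prop :=
  IsRegularAt (fun s => (∏ j ∈ J, (partialSum s j - partialSum p j)) * F s) p ∧
  ∀ i ∈ J, ¬ IsRegularAt (fun s => (∏ j ∈ J.erase i, (partialSum s j - partialSum p j)) * F s) p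

end

/-! Write S_j for the partial sums of s. Parametrize k_1 > ⋯ > k_r by gaps n_j + 1, so that the
numerator of the summand becomes ∏_j (q^{S_j})^{n_j+1}, and expand each (1 - q^{k_i})^{-s_i} by the
binomial series. The double series converges absolutely on `convergenceDomain`; summing the
geometric series in n first gives `qZetaSeries_eq_expansion`: up to (1-q)^{s_1+⋯+s_r}, the function
is a sum over m ∈ ℕ^r of binomial coefficients times ∏_j q^{S_j+M_j} / (1 - q^{S_j+M_j}), with M_j =
m_1 + ⋯ + m_j.

Where all Re S_j > -N, only the factors with M_j < N can be singular. Multiplying by ∏_j ∏_{n<N} (1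
- q^{S_j+n}) leaves a normally convergent series of holomorphic functions
(`analyticAt_clearedExpansion`), and that multiplier is locally a unit times one linear form for
each polar hyperplane through p (`exists_clearingFactor_factorization`). This gives the continuation
and bounds the order of the poles by one.

No linear form can be omitted: otherwise the cleared series would vanish near p on the hyperplane
S_i = w = p_1 + ⋯ + p_i, hence, by the identity theorem along a complex line, at the point w·e_i.
There every term but m = a·e_i, with a = -Re w, is zero, and that term is not
(`clearedExpansion_single_ne_zero`). Finally, any two continuations agree generically near every
point, so the result for this one passes to all. -/

/-! ### Analyticity of normally convergent series -/

open scoped BoundedContinuousFunction in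
/-- A uniformly bounded family of holomorphic functions on a disc is a holomorphic function with
values in the Banach algebra of bounded families. -/
theorem exists_analyticAt_boundedFamily {ι : Type*} [TopologicalSpace ι] [DiscreteTopology ι]
    (g : ι → ℂ → ℂ) (c : ℂ) {ρ : ℝ} (hρ : 0 < ρ)
    (hd : ∀ α, DifferentiableOn ℂ (g α) (Metric.ball c ρ))
    (hb : ∀ α, ∀ z ∈ Metric.ball c ρ, ‖g α z‖ ≤ 1) :
    ∃ u : ℂ → (ι →ᵇ ℂ), AnalyticAt ℂ u c ∧ ∀ᶠ z in 𝓝 c, ∀ α, u z α = g α z := by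
  -- Cauchy's estimates on the circle of radius R bound the n-th Taylor coefficients by R^{-n},
  -- uniformly in the index; on the disc of radius R/2 the vector-valued Taylor series is then
  -- dominated by ∑ 2^{-n}.
  set R : ℝ := ρ / 2 with hR
  have hR0 : 0 < R := by positivity
  have hcoef : ∀ n α, ‖((n.factorial : ℂ))⁻¹ • iteratedDeriv n (g α) c‖ ≤ 1 / R ^ n := by
    intro n α
    have hcl : closure (Metric.ball c R) ⊆ Metric.ball c ρ :=
      (Metric.closure_ball_subset_closedBall).trans (Metric.closedBall_subset_ball (by linarith))
    have h := Complex.norm_iteratedDeriv_le_of_forall_mem_sphere_norm_le (C := 1) n hR0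
      (f := g α) (c := c) (((hd α).mono hcl).diffContOnCl)
      (fun z hz => hb α z (Metric.sphere_subset_ball (by linarith) hz))
    rw [norm_smul, norm_inv, Complex.norm_natCast]
    have hn : (0 : ℝ) < n.factorial := by positivity
    rw [inv_mul_le_iff₀ hn]
    calc _ ≤ _ := h
      _ = _ := by ring
  let a : ℕ → (ι →ᵇ ℂ) := fun n =>
    BoundedContinuousFunction.ofNormedAddCommGroupDiscrete
      (fun α => ((n.factorial : ℂ))⁻¹ • iteratedDeriv n (g α) c) (1 / R ^ n) (hcoef n)
  have ha : ∀ n, ‖a n‖ ≤ 1 / R ^ n := fun n =>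
    BoundedContinuousFunction.norm_ofNormedAddCommGroup_le _ (by positivity) _
  have hle : ∀ (n : ℕ) (w : ℂ), w ∈ Metric.ball c (R / 2) →
      ‖(w - c) ^ n • a n‖ ≤ (1 / 2 : ℝ) ^ n := by
    intro n w hw
    rw [norm_smul, norm_pow]
    have hw' : ‖w - c‖ ≤ R / 2 := (mem_ball_iff_norm.1 hw).le
    calc ‖w - c‖ ^ n * ‖a n‖ ≤ (R / 2) ^ n * (1 / R ^ n) := by
          gcongr
          exact ha n
      _ = (1 / 2) ^ n := by
          rw [← one_div_pow, ← mul_pow]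
          congr 1
          field_simp
  have hgeo : Summable fun n : ℕ => (1 / 2 : ℝ) ^ n := summable_geometric_two
  refine ⟨fun z => ∑' n, (z - c) ^ n • a n, ?_, ?_⟩
  · have hdiff : DifferentiableOn ℂ (fun z => ∑' n, (z - c) ^ n • a n) (Metric.ball c (R / 2)) :=
      Complex.differentiableOn_tsum_of_summable_norm hgeo (fun n => by fun_prop)
        Metric.isOpen_ball hle
    exact hdiff.analyticAt (Metric.ball_mem_nhds c (by positivity))
  · filter_upwards [Metric.ball_mem_nhds c (show 0 < R / 2 by positivity)] with z hz α
    have hs : Summable fun n => (z - c) ^ n • a n :=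
      Summable.of_norm_bounded hgeo (fun n => hle n z hz)
    have h1 := (hs.hasSum.mapL (BoundedContinuousFunction.evalCLM ℂ α))
    have hz' : z ∈ Metric.ball c ρ := Metric.ball_subset_ball (by linarith) hz
    have h2 := Complex.hasSum_taylorSeries_on_ball (hd α) hz'
    have he : (fun n => BoundedContinuousFunction.evalCLM ℂ α ((z - c) ^ n • a n)) =
        fun n : ℕ => ((n.factorial : ℂ))⁻¹ • (z - c) ^ n • iteratedDeriv n (g α) c := by
      ext n
      change (z - c) ^ n * ((n.factorial : ℂ)⁻¹ * iteratedDeriv n (g α) c) = _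
      simp only [smul_eq_mul]
      ring
    rw [he] at h1
    exact h1.unique h2

open scoped BoundedContinuousFunction in
/-- A normally convergent series whose terms are products of holomorphic functions of linear
forms is analytic. -/
theorem analyticAt_tsum_prod_comp {ι K E : Type*} [Fintype K] [NormedAddCommGroup E]
    [NormedSpace ℂ E] (g : K → ι → ℂ → ℂ) (b : K → ι → ℝ) (L : K → E →L[ℂ] ℂ) (p : E)
    (hb0 : ∀ k α, 0 < b k α) (hb : Summable fun α => ∏ k, b k α)
    (hg : ∀ k, ∃ ρ > 0, ∀ α, DifferentiableOn ℂ (g k α) (Metric.ball (L k p) ρ) ∧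
      ∀ z ∈ Metric.ball (L k p) ρ, ‖g k α z‖ ≤ b k α) :
    AnalyticAt ℂ (fun z => ∑' α, ∏ k, g k α (L k z)) p := by
  -- With the discrete topology, bounded families form the Banach algebra `ι →ᵇ ℂ`. The series is
  -- the continuous linear functional x ↦ ∑ (∏ b) x applied to a finite product in this algebra.
  let _ : TopologicalSpace ι := ⊥
  have : DiscreteTopology ι := ⟨rfl⟩
  have hu : ∀ k, ∃ u : ℂ → (ι →ᵇ ℂ), AnalyticAt ℂ u (L k p) ∧
      ∀ᶠ z in 𝓝 (L k p), ∀ α, u z α = g k α z / b k α := by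
    intro k
    obtain ⟨ρ, hρ, h⟩ := hg k
    refine exists_analyticAt_boundedFamily (fun α z => g k α z / b k α) (L k p) hρ
      (fun α => (h α).1.div_const _) (fun α z hz => ?_)
    rw [norm_div, Complex.norm_real, Real.norm_of_nonneg (hb0 k α).le]
    exact div_le_one_of_le₀ ((h α).2 z hz) (hb0 k α).le
  choose u hu1 hu2 using hu
  have hsum : ∀ x : ι →ᵇ ℂ, Summable fun α => ((∏ k, b k α : ℝ) : ℂ) * x α := by
    intro x
    refine Summable.of_norm_bounded (hb.mul_right ‖x‖) (fun α => ?_)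
    rw [norm_mul, Complex.norm_real, Real.norm_of_nonneg (Finset.prod_nonneg fun k _ => (hb0 k α).le)]
    gcongr
    · exact Finset.prod_nonneg fun k _ => (hb0 k α).le
    · exact x.norm_coe_le_norm α
  let Λ₀ : (ι →ᵇ ℂ) →ₗ[ℂ] ℂ :=
    { toFun := fun x => ∑' α, ((∏ k, b k α : ℝ) : ℂ) * x α
      map_add' := fun x y => by
        rw [← (hsum x).tsum_add (hsum y)]
        simp [mul_add]
      map_smul' := fun t x => by
        simp only [BoundedContinuousFunction.coe_smul, smul_eq_mul, RingHom.id_apply]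
        rw [← tsum_mul_left]
        congr 1; ext α; ring }
  let Λ : (ι →ᵇ ℂ) →L[ℂ] ℂ := Λ₀.mkContinuous (∑' α, ∏ k, b k α) (fun x => by
    rw [← tsum_mul_right]
    refine tsum_of_norm_bounded (hb.mul_right ‖x‖).hasSum (fun α => ?_)
    rw [norm_mul, Complex.norm_real, Real.norm_of_nonneg (Finset.prod_nonneg fun k _ => (hb0 k α).le)]
    gcongr
    · exact Finset.prod_nonneg fun k _ => (hb0 k α).le
    · exact x.norm_coe_le_norm α)
  have hA : AnalyticAt ℂ (fun z => Λ (∏ k, u k (L k z))) p := by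
    have h1 : AnalyticAt ℂ (fun z => ∏ k, u k (L k z)) p := by
      refine Finset.analyticAt_fun_prod _ (fun k _ => ?_)
      exact (hu1 k).comp ((L k).analyticAt p)
    exact (Λ.analyticAt _).comp h1
  refine hA.congr ?_
  have hev : ∀ᶠ z in 𝓝 p, ∀ k, ∀ α, u k (L k z) α = g k α (L k z) / b k α := by
    rw [eventually_all]
    intro k
    exact (L k).continuous.continuousAt.eventually (hu2 k)
  filter_upwards [hev] with z hz
  change ∑' α, ((∏ k, b k α : ℝ) : ℂ) * (∏ k, u k (L k z)) α = _
  congr 1; ext α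
  have : (∏ k, u k (L k z)) α = ∏ k, u k (L k z) α := by
    simp
  rw [this, Complex.ofReal_prod, ← Finset.prod_mul_distrib]
  refine Finset.prod_congr rfl fun k _ => ?_
  rw [hz k α]
  exact mul_div_cancel₀ _ (Complex.ofReal_ne_zero.2 (hb0 k α).ne')

/-! ### Germs of analytic functions -/

section Germs

variable {E : Type*} [NormedAddCommGroup E] [NormedSpace ℂ E]

theorem AnalyticAt.exists_ball {f : E → ℂ} {p : E} (hf : AnalyticAt ℂ f p) :
    ∃ ρ > 0, AnalyticOnNhd ℂ f (Metric.ball p ρ) := by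
  obtain ⟨ρ, hρ, h⟩ := Metric.eventually_nhds_iff_ball.1 hf.eventually_analyticAt
  exact ⟨ρ, hρ, h⟩

/-- On a ball, an analytic function vanishing near some point vanishes identically. -/
theorem AnalyticOnNhd.eqOn_zero_ball {f : E → ℂ} {p a : E} {ρ : ℝ}
    (hf : AnalyticOnNhd ℂ f (Metric.ball p ρ)) (ha : a ∈ Metric.ball p ρ)
    (h : ∀ᶠ z in 𝓝 a, f z = 0) : ∀ z ∈ Metric.ball p ρ, f z = 0 := by
  let _ : NormedSpace ℝ E := NormedSpace.restrictScalars ℝ ℂ E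
  exact fun z hz => hf.eqOn_zero_of_preconnected_of_eventuallyEq_zero
    (convex_ball p ρ).isPreconnected ha h hz

/-- The ring of germs of analytic functions has no zero divisors. -/
theorem AnalyticAt.eventually_eq_zero_of_mul {f g : E → ℂ} {p : E} (hf : AnalyticAt ℂ f p)
    (hg : AnalyticAt ℂ g p) (h : ∀ᶠ z in 𝓝 p, f z * g z = 0) (hg0 : ¬ ∀ᶠ z in 𝓝 p, g z = 0) :
    ∀ᶠ z in 𝓝 p, f z = 0 := by
  obtain ⟨ρ₁, h1, hf'⟩ := hf.exists_ball
  obtain ⟨ρ, hρ, h'⟩ := Metric.eventually_nhds_iff_ball.1 h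
  have hmin : 0 < min ρ₁ ρ := lt_min h1 hρ
  have hfr : ∃ᶠ z in 𝓝 p, g z ≠ 0 := not_eventually.1 hg0
  obtain ⟨a, ha0, ha1, ha2⟩ := (hfr.and_eventually
    ((hg.eventually_continuousAt).and (Metric.ball_mem_nhds p hmin))).exists
  have hz : ∀ᶠ z in 𝓝 a, f z = 0 := by
    filter_upwards [ha1.eventually_ne ha0, Metric.isOpen_ball.mem_nhds ha2] with z hz1 hz2
    exact (mul_eq_zero.1 (h' z (Metric.ball_subset_ball (min_le_right _ _) hz2))).resolve_right hz1
  have := (hf'.mono (Metric.ball_subset_ball (min_le_left ρ₁ ρ))).eqOn_zero_ball ha2 hz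
  filter_upwards [Metric.ball_mem_nhds p hmin] with z hz using this z hz

theorem AnalyticAt.not_eventually_mul_eq_zero {f g : E → ℂ} {p : E} (hf : AnalyticAt ℂ f p)
    (hg : AnalyticAt ℂ g p) (hf0 : ¬ ∀ᶠ z in 𝓝 p, f z = 0) (hg0 : ¬ ∀ᶠ z in 𝓝 p, g z = 0) :
    ¬ ∀ᶠ z in 𝓝 p, f z * g z = 0 :=
  fun h => hf0 (hf.eventually_eq_zero_of_mul hg h hg0)

theorem not_eventually_prod_eq_zero {ι : Type*} (s : Finset ι) {f : ι → E → ℂ} {p : E}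
    (hf : ∀ i ∈ s, AnalyticAt ℂ (f i) p) (h0 : ∀ i ∈ s, ¬ ∀ᶠ z in 𝓝 p, f i z = 0) :
    ¬ ∀ᶠ z in 𝓝 p, ∏ i ∈ s, f i z = 0 := by
  classical
  induction s using Finset.induction_on with
  | empty => simpa using (NeBot.ne inferInstance)
  | insert i s hi ih =>
    simp only [Finset.prod_insert hi]
    refine (hf i (by simp)).not_eventually_mul_eq_zero
      (Finset.analyticAt_fun_prod s fun j hj => hf j (by simp [hj])) (h0 i (by simp))
      (ih (fun j hj => hf j (by simp [hj])) fun j hj => h0 j (by simp [hj]))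

end Germs

/-! ### Generic agreement and uniqueness of meromorphic continuation -/

/-- `F` and `G` agree near `p`, off the zero set of a nonzero analytic germ. -/
def AgreeGenericallyAt {r : ℕ} (F G : (Fin r → ℂ) → ℂ) (p : Fin r → ℂ) : Prop :=
  ∃ h : (Fin r → ℂ) → ℂ, AnalyticAt ℂ h p ∧ (¬ ∀ᶠ z in 𝓝 p, h z = 0) ∧
    ∀ᶠ z in 𝓝 p, h z ≠ 0 → F z = G z

namespace AgreeGenericallyAt

variable {r : ℕ} {F G : (Fin r → ℂ) → ℂ} {p : Fin r → ℂ}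

theorem symm (h : AgreeGenericallyAt F G p) : AgreeGenericallyAt G F p := by
  obtain ⟨k, h1, h2, h3⟩ := h
  exact ⟨k, h1, h2, h3.mono fun z hz hk => (hz hk).symm⟩

theorem trans {H : (Fin r → ℂ) → ℂ} (h : AgreeGenericallyAt F G p)
    (h' : AgreeGenericallyAt G H p) : AgreeGenericallyAt F H p := by
  obtain ⟨k, h1, h2, h3⟩ := h
  obtain ⟨k', h1', h2', h3'⟩ := h'
  refine ⟨fun z => k z * k' z, h1.mul h1', h1.not_eventually_mul_eq_zero h1' h2 h2', ?_⟩
  filter_upwards [h3, h3'] with z hz hz' hk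
  rw [hz (left_ne_zero_of_mul hk), hz' (right_ne_zero_of_mul hk)]

theorem mul_left (A : (Fin r → ℂ) → ℂ) (h : AgreeGenericallyAt F G p) :
    AgreeGenericallyAt (fun z => A z * F z) (fun z => A z * G z) p := by
  obtain ⟨k, h1, h2, h3⟩ := h
  exact ⟨k, h1, h2, h3.mono fun z hz hk => by simp only [hz hk]⟩

theorem isRegularAt (h : AgreeGenericallyAt F G p) (hG : IsRegularAt G p) : IsRegularAt F p := by
  obtain ⟨φ, k, h0, h1, h2, h3⟩ := hG
  obtain ⟨l, l1, l2, l3⟩ := h.trans ⟨k, h1, h2, h3⟩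
  exact ⟨φ, l, h0, l1, l2, l3⟩

end AgreeGenericallyAt

/-- Two meromorphic functions agreeing generically near one point do so near every point. -/
theorem agreeGenericallyAt_of_isMeromorphicAt {r : ℕ} {F G : (Fin r → ℂ) → ℂ}
    (hF : ∀ p, IsMeromorphicAt F p) (hG : ∀ p, IsMeromorphicAt G p) {p₀ : Fin r → ℂ}
    (h₀ : AgreeGenericallyAt F G p₀) (p : Fin r → ℂ) : AgreeGenericallyAt F G p := by
  have hopen : IsOpen {p | AgreeGenericallyAt F G p} := by
    refine isOpen_iff_mem_nhds.2 fun a ha => ?_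
    obtain ⟨h, h1, h2, h3⟩ := ha
    obtain ⟨ρ, hρ, hb⟩ := h1.exists_ball
    filter_upwards [Metric.ball_mem_nhds a hρ, h3.eventually_nhds] with z hz hz3
    refine ⟨h, hb z hz, fun h0 => h2 ?_, hz3⟩
    filter_upwards [Metric.ball_mem_nhds a hρ] with w hw using hb.eqOn_zero_ball hz h0 w hw
  have hclosed : IsClosed {p | AgreeGenericallyAt F G p} := by
    refine isClosed_of_closure_subset fun p hp => ?_
    obtain ⟨g₁, h₁, hg₁, hh₁, hn₁, he₁⟩ := hF p
    obtain ⟨g₂, h₂, hg₂, hh₂, hn₂, he₂⟩ := hG p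
    -- For closedness, cross-multiply: this numerator of F - G vanishes near a nearby point of
    -- agreement, hence on a whole ball about p.
    have hD : AnalyticAt ℂ (fun z => g₁ z * h₂ z - g₂ z * h₁ z) p :=
      (hg₁.mul hh₂).sub (hg₂.mul hh₁)
    obtain ⟨ρ, hρ, hball⟩ := Metric.eventually_nhds_iff_ball.1
      ((hD.eventually_analyticAt.and (hh₁.eventually_analyticAt.and hh₂.eventually_analyticAt)).and
        (he₁.and he₂))
    obtain ⟨a, ha, hap⟩ := Metric.mem_closure_iff.1 hp ρ hρ
    have ha' : a ∈ Metric.ball p ρ := by rwa [Metric.mem_ball, dist_comm]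
    obtain ⟨k, hk1, hk2, hk3⟩ := ha
    have hball_nhds := Metric.isOpen_ball.mem_nhds ha'
    have hn : ∀ h : (Fin r → ℂ) → ℂ, (∀ z ∈ Metric.ball p ρ, AnalyticAt ℂ h z) →
        (¬ ∀ᶠ z in 𝓝 p, h z = 0) → ¬ ∀ᶠ z in 𝓝 a, h z = 0 := by
      intro h hA hne h0
      refine hne ?_
      filter_upwards [Metric.ball_mem_nhds p hρ] with z hz
      exact AnalyticOnNhd.eqOn_zero_ball (fun z hz => hA z hz) ha' h0 z hz
    have hA1 : ∀ z ∈ Metric.ball p ρ, AnalyticAt ℂ h₁ z := fun z hz => (hball z hz).1.2.1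
    have hA2 : ∀ z ∈ Metric.ball p ρ, AnalyticAt ℂ h₂ z := fun z hz => (hball z hz).1.2.2
    have hAD : AnalyticOnNhd ℂ (fun z => g₁ z * h₂ z - g₂ z * h₁ z) (Metric.ball p ρ) :=
      fun z hz => (hball z hz).1.1
    have hzero : ∀ᶠ z in 𝓝 a, g₁ z * h₂ z - g₂ z * h₁ z = 0 := by
      refine (hAD a ha').eventually_eq_zero_of_mul
        (g := fun z => k z * (h₁ z * h₂ z)) (hk1.mul ((hA1 a ha').mul (hA2 a ha'))) ?_
        (hk1.not_eventually_mul_eq_zero ((hA1 a ha').mul (hA2 a ha')) hk2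
          ((hA1 a ha').not_eventually_mul_eq_zero (hA2 a ha') (hn _ hA1 hn₁) (hn _ hA2 hn₂)))
      filter_upwards [hk3, hball_nhds] with z hz hzb
      by_cases c0 : k z = 0
      · simp [c0]
      by_cases c1 : h₁ z = 0
      · simp [c1]
      by_cases c2 : h₂ z = 0
      · simp [c2]
      have e := hz c0
      rw [(hball z hzb).2.1 c1, (hball z hzb).2.2 c2, div_eq_div_iff c1 c2] at e
      rw [e, sub_self, zero_mul]
    have hall := hAD.eqOn_zero_ball ha' hzero
    refine ⟨fun z => h₁ z * h₂ z, hh₁.mul hh₂, hh₁.not_eventually_mul_eq_zero hh₂ hn₁ hn₂, ?_⟩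
    filter_upwards [Metric.ball_mem_nhds p hρ] with z hz hne
    have c1 := left_ne_zero_of_mul hne
    have c2 := right_ne_zero_of_mul hne
    rw [(hball z hz).2.1 c1, (hball z hz).2.2 c2, div_eq_div_iff c1 c2]
    exact sub_eq_zero.1 (hall z hz)
  have huniv := IsClopen.eq_univ ⟨hclosed, hopen⟩ ⟨p₀, h₀⟩
  exact Set.eq_univ_iff_forall.1 huniv p

theorem summable_norm_prod_and_tsum_prod {R : Type*} [NormedField R] [CompleteSpace R] (r : ℕ)
    (f : Fin r → ℕ → R) (hf : ∀ j, Summable fun n => ‖f j n‖) :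
    (Summable fun n : Fin r → ℕ => ‖∏ j, f j (n j)‖) ∧
      ∑' n : Fin r → ℕ, ∏ j, f j (n j) = ∏ j, ∑' n, f j n := by
  induction r with
  | zero =>
    refine ⟨Summable.of_finite, ?_⟩
    simp
  | succ r ih =>
    obtain ⟨h1, h2⟩ := ih (fun j => f j.succ) (fun j => hf j.succ)
    let e := Fin.consEquiv (fun _ : Fin (r + 1) => ℕ)
    have he : ∀ x : ℕ × (Fin r → ℕ), ∏ j, f j (e x j) = f 0 x.1 * ∏ j, f (Fin.succ j) (x.2 j) := by
      intro x
      rw [Fin.prod_univ_succ]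
      simp [e, Fin.consEquiv]
    constructor
    · rw [← e.summable_iff]
      refine ((hf 0).mul_norm h1).congr fun x => ?_
      rw [Function.comp_apply, he]
    · rw [← e.tsum_eq, Fin.prod_univ_succ, ← h2, tsum_mul_tsum_of_summable_norm (hf 0) h1]
      exact tsum_congr he

/-! ### The binomial series -/

section Binomial

/-- The coefficient of `x ^ m` in `(1 - x) ^ (-s)`. -/
noncomputable def risingCoeff {R : Type*} [Field R] (m : ℕ) (s : R) : R :=
  ∏ t ∈ Finset.range m, (s + t) / (t + 1)

theorem risingCoeff_eq_choose (m : ℕ) (s : ℂ) : risingCoeff m s = Ring.choose (s + m - 1) m := by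
  rw [← Ring.multichoose_eq]
  have h := Ring.factorial_nsmul_multichoose_eq_ascPochhammer s m
  rw [Polynomial.ascPochhammer_smeval_eq_eval] at h
  have hm : (m.factorial : ℂ) ≠ 0 := by exact_mod_cast m.factorial_ne_zero
  rw [nsmul_eq_mul] at h
  refine mul_left_cancel₀ hm ?_
  rw [h]
  clear h hm
  induction m with
  | zero => simp [risingCoeff]
  | succ m ih =>
    rw [ascPochhammer_succ_eval, ← ih, risingCoeff, risingCoeff, Finset.prod_range_succ,
      Nat.factorial_succ]
    have : (m : ℂ) + 1 ≠ 0 := by exact_mod_cast m.succ_ne_zero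
    push_cast
    field_simp

theorem hasSum_risingCoeff (s : ℂ) {x : ℂ} (hx : ‖x‖ < 1) :
    HasSum (fun m => risingCoeff m s * x ^ m) ((1 - x) ^ (-s)) := by
  have h := (Complex.one_div_one_sub_cpow_hasFPowerSeriesOnBall_zero s).hasSum (y := x)
    (by simpa [enorm_eq_nnnorm, ← NNReal.coe_lt_coe] using hx)
  rw [zero_add, one_div, ← Complex.cpow_neg] at h
  have he : (fun m => risingCoeff m s * x ^ m) = fun n =>
      (FormalMultilinearSeries.ofScalars ℂ (fun n : ℕ => Ring.choose (s + n - 1) n) n)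
        fun _ => x := by
    ext m
    simp [risingCoeff_eq_choose, FormalMultilinearSeries.ofScalars]
  rw [he]
  exact h

theorem norm_risingCoeff_le (m : ℕ) {s : ℂ} {R : ℝ} (hs : ‖s‖ ≤ R) :
    ‖risingCoeff m s‖ ≤ risingCoeff m R := by
  rw [risingCoeff, risingCoeff, norm_prod]
  refine Finset.prod_le_prod (fun _ _ => norm_nonneg _) fun t _ => ?_
  rw [norm_div]
  have h1 : ‖(t : ℂ) + 1‖ = t + 1 := by
    rw [← Nat.cast_succ, Complex.norm_natCast, Nat.cast_succ]
  rw [h1]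
  gcongr
  calc ‖s + t‖ ≤ ‖s‖ + ‖(t : ℂ)‖ := norm_add_le _ _
    _ ≤ R + t := by rw [Complex.norm_natCast]; gcongr

theorem risingCoeff_pos (m : ℕ) {R : ℝ} (hR : 0 < R) : 0 < risingCoeff m R :=
  Finset.prod_pos fun t _ => by positivity

theorem ofReal_risingCoeff (m : ℕ) (R : ℝ) : ((risingCoeff m R : ℝ) : ℂ) = risingCoeff m (R : ℂ) := by
  simp [risingCoeff]

theorem summable_risingCoeff (R : ℝ) {x : ℝ} (hx0 : 0 ≤ x) (hx : x < 1) :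
    Summable fun m => risingCoeff m R * x ^ m := by
  have h := (hasSum_risingCoeff (R : ℂ) (x := (x : ℂ))
    (by rwa [Complex.norm_real, Real.norm_of_nonneg hx0])).summable
  rw [← Complex.summable_ofReal]
  refine h.congr fun m => ?_
  push_cast [ofReal_risingCoeff]
  rfl

end Binomial

/-! ### Decreasing tuples and their gaps -/

section PartialSums

variable {r : ℕ}

theorem eq_of_sum_Iic_eq {m m' : Fin r → ℕ}
    (h : ∀ j, ∑ i ∈ Finset.Iic j, m i = ∑ i ∈ Finset.Iic j, m' i) : m = m' := by
  ext j
  induction j using WellFoundedLT.induction with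
  | ind j ih =>
    have hj := h j
    rw [← Finset.Iio_insert, Finset.sum_insert (by simp), Finset.sum_insert (by simp),
      Finset.sum_congr rfl fun i hi => ih i (Finset.mem_Iio.1 hi)] at hj
    exact Nat.add_right_cancel hj

/-- The strictly decreasing tuple with gaps `n_j + 1`. -/
def tupleOfGaps (n : Fin r → ℕ) : DecreasingTuple r :=
  ⟨fun i => ∑ j ∈ Finset.Ici i, (n j + 1), by
    refine ⟨fun i j hij => ?_, fun i => ?_⟩
    · refine Finset.sum_lt_sum_of_subset (Finset.Ici_subset_Ici.2 hij.le) (i := i) (by simp)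
        (by simpa using hij) (by simp) (by simp)
    · calc 1 ≤ n i + 1 := by simp
        _ ≤ _ := Finset.single_le_sum (f := fun j => n j + 1) (by simp) (by simp)⟩

theorem tupleOfGaps_bijective : Function.Bijective (tupleOfGaps (r := r)) := by
  have hstep : ∀ (f : Fin r → ℕ) (i : Fin r),
      ∑ j ∈ Finset.Ici i, f j = f i + ∑ j ∈ Finset.Ioi i, f j := by
    intro f i
    rw [← Finset.Ioi_insert, Finset.sum_insert (by simp)]
  constructor
  · intro n n' h
    have h' : ∀ i, ∑ j ∈ Finset.Ici i, (n j + 1) = ∑ j ∈ Finset.Ici i, (n' j + 1) :=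
      fun i => congrFun (congrArg Subtype.val h) i
    ext j
    induction j using WellFoundedGT.induction with
    | ind j ih =>
      have hj := h' j
      rw [hstep, hstep, Finset.sum_congr rfl fun i hi =>
        congrArg (· + 1) (ih i (Finset.mem_Ioi.1 hi))] at hj
      omega
  · rintro ⟨k, hk, hk1⟩
    -- The last entry has no successor; the value 0 in its place makes the last gap k_r itself.
    let n : Fin r → ℕ := fun i => k i - (if h : i.1 + 1 < r then k ⟨i.1 + 1, h⟩ else 0) - 1
    refine ⟨n, Subtype.ext (funext fun i => ?_)⟩
    change ∑ j ∈ Finset.Ici i, (n j + 1) = k i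
    induction i using WellFoundedGT.induction with
    | ind i ih =>
      rw [hstep]
      by_cases h : i.1 + 1 < r
      · have hIoi : Finset.Ioi i = Finset.Ici (⟨i.1 + 1, h⟩ : Fin r) := by
          ext x
          simp only [Finset.mem_Ioi, Finset.mem_Ici, Fin.lt_def, Fin.le_def]
          omega
        have hlt : i < (⟨i.1 + 1, h⟩ : Fin r) := by simp [Fin.lt_def]
        rw [hIoi, ih _ hlt]
        have h2 := hk hlt
        simp only [n, dif_pos h]
        omega
      · have hIoi : Finset.Ioi i = ∅ := by
          ext x
          have := x.2
          simp only [Finset.mem_Ioi, Fin.lt_def, Finset.notMem_empty, iff_false]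
          omega
        rw [hIoi, Finset.sum_empty]
        have h2 := hk1 i
        simp only [n, dif_neg h]
        omega

/-- Abel summation: exchange the sums over i ≤ j. -/
theorem sum_tupleOfGaps_mul (n : Fin r → ℕ) (t : Fin r → ℂ) :
    ∑ i, (((tupleOfGaps n).1 i : ℕ) : ℂ) * t i = ∑ j, ((n j : ℂ) + 1) * partialSum t j := by
  simp only [tupleOfGaps, partialSum, Nat.cast_sum, Finset.sum_mul, Finset.mul_sum]
  rw [Finset.sum_comm' (t' := Finset.univ) (s' := fun j => Finset.Iic j) (by simp)]
  simp

end PartialSums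

/-! ### Rearrangement of the series -/

section Series

variable {q : ℝ} {r : ℕ}

theorem norm_ofReal_cpow_lt_one (hq0 : 0 < q) (hq1 : q < 1) {w : ℂ} (hw : 0 < w.re) :
    ‖(q : ℂ) ^ w‖ < 1 := by
  rw [Complex.norm_cpow_eq_rpow_re_of_pos hq0]
  exact Real.rpow_lt_one hq0.le hq1 hw

theorem cpow_sum_eq_prod {ι : Type*} (t : Finset ι) (f : ι → ℂ) {a : ℂ} (ha : a ≠ 0) :
    a ^ (∑ i ∈ t, f i) = ∏ i ∈ t, a ^ f i := by
  classical
  induction t using Finset.induction_on with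
  | empty => simp
  | insert i t hi ih => rw [Finset.sum_insert hi, Finset.prod_insert hi, Complex.cpow_add _ _ ha, ih]

/-- The summand after expanding each `(1 - q ^ k_i) ^ (-s_i)` by the binomial series. -/
noncomputable def expandedTerm (q : ℝ) (s : Fin r → ℂ) (m n : Fin r → ℕ) : ℂ :=
  ∏ i, ((q : ℂ) ^ ((((tupleOfGaps n).1 i : ℕ) : ℂ) * s i) *
    (risingCoeff (m i) (s i) * ((q : ℂ) ^ (tupleOfGaps n).1 i) ^ m i))

theorem prod_cpow_tupleOfGaps (hq0 : 0 < q) (n : Fin r → ℕ) (t : Fin r → ℂ) :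
    ∏ i, (q : ℂ) ^ ((((tupleOfGaps n).1 i : ℕ) : ℂ) * t i) =
      ∏ j, ((q : ℂ) ^ partialSum t j) ^ (n j + 1) := by
  have hq : (q : ℂ) ≠ 0 := by exact_mod_cast hq0.ne'
  rw [← cpow_sum_eq_prod _ _ hq, sum_tupleOfGaps_mul, cpow_sum_eq_prod _ _ hq]
  refine Finset.prod_congr rfl fun j _ => ?_
  rw [← Complex.cpow_nat_mul]
  push_cast
  rfl

theorem one_le_tupleOfGaps (n : Fin r → ℕ) (i : Fin r) : 1 ≤ (tupleOfGaps n).1 i :=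
  (tupleOfGaps n).2.2 i

theorem qZetaTerm_tupleOfGaps (hq0 : 0 < q) (hq1 : q < 1) (s : Fin r → ℂ) (n : Fin r → ℕ) :
    HasSum (fun m => ((1 - q : ℝ) : ℂ) ^ (∑ i, s i) * expandedTerm q s m n)
      (qZetaTerm q s (tupleOfGaps n)) := by
  have hq : (q : ℂ) ≠ 0 := by exact_mod_cast hq0.ne'
  have h1q : 0 < 1 - q := by linarith
  have h1q' : ((1 - q : ℝ) : ℂ) ≠ 0 := by exact_mod_cast h1q.ne'
  set k := (tupleOfGaps n).1 with hk
  have hlt : ∀ i, ‖(q : ℂ) ^ k i‖ < 1 := by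
    intro i
    rw [norm_pow, Complex.norm_real, Real.norm_of_nonneg hq0.le]
    exact pow_lt_one₀ hq0.le hq1 (Nat.one_le_iff_ne_zero.1 (one_le_tupleOfGaps n i))
  have hs : ∀ i, HasSum (fun m => (q : ℂ) ^ ((k i : ℂ) * s i) *
      (risingCoeff m (s i) * ((q : ℂ) ^ k i) ^ m))
      ((q : ℂ) ^ ((k i : ℂ) * s i) * (1 - (q : ℂ) ^ k i) ^ (-s i)) :=
    fun i => (hasSum_risingCoeff (s i) (hlt i)).mul_left _
  obtain ⟨h1, h2⟩ := summable_norm_prod_and_tsum_prod r _ (fun i => (hs i).summable.norm)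
  have h3 := h1.of_norm.hasSum
  rw [h2] at h3
  simp only [(hs _).tsum_eq] at h3
  have h4 := h3.mul_left (((1 - q : ℝ) : ℂ) ^ (∑ i, s i))
  suffices hT : qZetaTerm q s (tupleOfGaps n) = ((1 - q : ℝ) : ℂ) ^ (∑ i, s i) *
      ∏ i, ((q : ℂ) ^ ((k i : ℂ) * s i) * (1 - (q : ℂ) ^ k i) ^ (-s i)) by
    rw [hT]
    exact h4
  unfold qZetaTerm
  rw [ cpow_sum_eq_prod _ _ hq, cpow_sum_eq_prod _ _ h1q', ← Finset.prod_mul_distrib,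
    ← Finset.prod_div_distrib]
  refine Finset.prod_congr rfl fun i _ => ?_
  have hpos : 0 < 1 - q ^ k i := by
    have := hlt i
    rw [norm_pow, Complex.norm_real, Real.norm_of_nonneg hq0.le] at this
    linarith
  have hnum : 0 < qNumber q (k i) := div_pos hpos h1q
  have hne : ((qNumber q (k i) : ℝ) : ℂ) ^ s i ≠ 0 := by
    rw [Complex.cpow_ne_zero_iff]
    left
    exact_mod_cast hnum.ne'
  have hmul : (1 - (q : ℂ) ^ k i) ^ s i =
      ((qNumber q (k i) : ℝ) : ℂ) ^ s i * ((1 - q : ℝ) : ℂ) ^ s i := by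
    rw [← Complex.mul_cpow_ofReal_nonneg hnum.le h1q.le, ← Complex.ofReal_mul, qNumber,
      div_mul_cancel₀ _ h1q.ne']
    push_cast
    rfl
  have hne' : ((1 - q : ℝ) : ℂ) ^ s i ≠ 0 := by
    rw [Complex.cpow_ne_zero_iff]
    exact Or.inl h1q'
  rw [Complex.cpow_neg, hmul]
  change (q : ℂ) ^ ((k i : ℂ) * s i) / ((qNumber q (k i) : ℝ) : ℂ) ^ s i = _
  generalize (q : ℂ) ^ ((k i : ℂ) * s i) = x
  field_simp

/-- The factor (q^{k_i})^{m_i} merely shifts s_i to s_i + m_i, so the formula for the numerator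
applies to the shifted exponents. -/
theorem expandedTerm_eq (hq0 : 0 < q) (s : Fin r → ℂ) (m n : Fin r → ℕ) :
    expandedTerm q s m n = (∏ i, risingCoeff (m i) (s i)) *
      ∏ j, ((q : ℂ) ^ (partialSum s j + ((∑ i ∈ Finset.Iic j, m i : ℕ) : ℂ))) ^ (n j + 1) := by
  have hq : (q : ℂ) ≠ 0 := by exact_mod_cast hq0.ne'
  have h := prod_cpow_tupleOfGaps hq0 n (fun i => s i + m i)
  have h' : ∀ j, partialSum (fun i => s i + m i) j =
      partialSum s j + ((∑ i ∈ Finset.Iic j, m i : ℕ) : ℂ) := by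
    intro j
    simp [partialSum, Finset.sum_add_distrib]
  simp only [h'] at h
  rw [← h, ← Finset.prod_mul_distrib, expandedTerm]
  refine Finset.prod_congr rfl fun i _ => ?_
  rw [mul_add, Complex.cpow_add _ _ hq, ← Nat.cast_mul, Complex.cpow_natCast, pow_mul]
  ring

/-- Since k_i ≥ 1, q^{k_i m_i} ≤ q^{m_i}; this decouples m from n, leaving a binomial series at q
times a product of geometric series. -/
theorem summable_norm_expandedTerm (hq0 : 0 < q) (hq1 : q < 1) {s : Fin r → ℂ}
    (hs : s ∈ convergenceDomain r) :
    Summable fun x : (Fin r → ℕ) × (Fin r → ℕ) => ‖expandedTerm q s x.1 x.2‖ := by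
  have hA : Summable fun m : Fin r → ℕ => ‖∏ i, risingCoeff (m i) ‖s i‖ * q ^ m i‖ :=
    (summable_norm_prod_and_tsum_prod r (fun i m => risingCoeff m ‖s i‖ * q ^ m)
      (fun i => (summable_risingCoeff ‖s i‖ hq0.le hq1).norm)).1
  have hB : Summable fun n : Fin r → ℕ => ‖∏ j, ((q : ℂ) ^ partialSum s j) ^ (n j + 1)‖ := by
    refine (summable_norm_prod_and_tsum_prod r (fun j n => ((q : ℂ) ^ partialSum s j) ^ (n + 1))
      (fun j => ?_)).1
    have := summable_norm_geometric_of_norm_lt_one (norm_ofReal_cpow_lt_one hq0 hq1 (hs j))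
    exact (summable_nat_add_iff (f := fun n => ‖((q : ℂ) ^ partialSum s j) ^ n‖) 1).2 this
  have hAB : Summable fun x : (Fin r → ℕ) × (Fin r → ℕ) =>
      ‖∏ i, risingCoeff (x.1 i) ‖s i‖ * q ^ x.1 i‖ *
        ‖∏ j, ((q : ℂ) ^ partialSum s j) ^ (x.2 j + 1)‖ :=
    hA.mul_of_nonneg hB (fun _ => norm_nonneg _) (fun _ => norm_nonneg _)
  refine Summable.of_nonneg_of_le (fun _ => norm_nonneg _) (fun x => ?_) hAB
  rw [expandedTerm, Finset.prod_mul_distrib, norm_mul, prod_cpow_tupleOfGaps hq0, mul_comm]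
  refine mul_le_mul_of_nonneg_right ?_ (norm_nonneg _)
  rw [norm_prod, norm_prod]
  refine Finset.prod_le_prod (fun _ _ => norm_nonneg _) fun i _ => ?_
  rw [norm_mul, norm_mul, norm_pow, norm_pow, norm_pow, Complex.norm_real]
  refine mul_le_mul ((norm_risingCoeff_le _ le_rfl).trans (Real.le_norm_self _)) ?_
    (by positivity) (norm_nonneg _)
  rw [Real.norm_of_nonneg hq0.le, ← pow_mul]
  exact pow_le_pow_of_le_one hq0.le hq1.le (Nat.le_mul_of_pos_left _ (one_le_tupleOfGaps x.2 i))

theorem summable_qZetaTerm (hq0 : 0 < q) (hq1 : q < 1) {s : Fin r → ℂ}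
    (hs : s ∈ convergenceDomain r) : Summable fun k : DecreasingTuple r => qZetaTerm q s k := by
  rw [← (Equiv.ofBijective _ (tupleOfGaps_bijective (r := r))).summable_iff]
  have h : Summable fun n : Fin r → ℕ =>
      ∑' m, ((1 - q : ℝ) : ℂ) ^ (∑ i, s i) * expandedTerm q s m n :=
    ((summable_norm_expandedTerm hq0 hq1 hs).of_norm.mul_left
      (((1 - q : ℝ) : ℂ) ^ (∑ i, s i))).prod_symm.prod
  refine h.congr fun n => Eq.symm ?_
  exact (qZetaTerm_tupleOfGaps hq0 hq1 s n).tsum_eq.symm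

/-- The series in the binomial indices, defined on all of `ℂ^r`. -/
noncomputable def qZetaExpansion (q : ℝ) {r : ℕ} (s : Fin r → ℂ) : ℂ :=
  ((1 - q : ℝ) : ℂ) ^ (∑ i, s i) * ∑' m : Fin r → ℕ, (∏ i, risingCoeff (m i) (s i)) *
    ∏ j, ((q : ℂ) ^ (partialSum s j + ((∑ i ∈ Finset.Iic j, m i : ℕ) : ℂ)) /
      (1 - (q : ℂ) ^ (partialSum s j + ((∑ i ∈ Finset.Iic j, m i : ℕ) : ℂ))))

theorem qZetaSeries_eq_expansion (hq0 : 0 < q) (hq1 : q < 1) {s : Fin r → ℂ}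
    (hs : s ∈ convergenceDomain r) : qZetaSeries q s = qZetaExpansion q s := by
  have h := summable_norm_expandedTerm hq0 hq1 hs
  rw [qZetaSeries, ← (Equiv.ofBijective _ (tupleOfGaps_bijective (r := r))).tsum_eq]
  have h1 : ∀ n, qZetaTerm q s (tupleOfGaps n) =
      ((1 - q : ℝ) : ℂ) ^ (∑ i, s i) * ∑' m, expandedTerm q s m n := fun n => by
    rw [← (qZetaTerm_tupleOfGaps hq0 hq1 s n).tsum_eq, tsum_mul_left]
  simp only [Equiv.ofBijective_apply, h1]
  rw [tsum_mul_left, qZetaExpansion]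
  congr 1
  rw [Summable.tsum_comm (f := expandedTerm q s) h.of_norm]
  refine tsum_congr fun m => ?_
  simp only [expandedTerm_eq hq0]
  rw [tsum_mul_left]
  congr 1
  have hlt : ∀ j, ‖(q : ℂ) ^ (partialSum s j + ((∑ i ∈ Finset.Iic j, m i : ℕ) : ℂ))‖ < 1 := by
    intro j
    refine norm_ofReal_cpow_lt_one hq0 hq1 ?_
    rw [Complex.add_re, Complex.natCast_re]
    have := hs j
    positivity
  have hgeo : ∀ j, Summable fun n : ℕ =>
      ‖((q : ℂ) ^ (partialSum s j + ((∑ i ∈ Finset.Iic j, m i : ℕ) : ℂ))) ^ (n + 1)‖ :=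
    fun j => (summable_nat_add_iff 1).2 (summable_norm_geometric_of_norm_lt_one (hlt j))
  rw [(summable_norm_prod_and_tsum_prod r (fun j n =>
    ((q : ℂ) ^ (partialSum s j + ((∑ i ∈ Finset.Iic j, m i : ℕ) : ℂ))) ^ (n + 1)) hgeo).2]
  refine Finset.prod_congr rfl fun j _ => ?_
  simp only [pow_succ']
  rw [tsum_mul_left, tsum_geometric_of_norm_lt_one (hlt j), div_eq_mul_inv]

end Series

/-! ### The one-variable factors and their poles -/

section PoleFactor

variable {q : ℝ}

/-- `∏_{n < N} (1 - q ^ (w + n))`. -/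
noncomputable def shiftedProd (q : ℝ) (N : ℕ) (w : ℂ) : ℂ :=
  ∏ n ∈ Finset.range N, (1 - (q : ℂ) ^ (w + n))

/-- `q ^ (w + M) / (1 - q ^ (w + M)) * ∏_{n < N} (1 - q ^ (w + n))`, with the common factor
cancelled when `M < N`. -/
noncomputable def clearedFactor (q : ℝ) (N M : ℕ) (w : ℂ) : ℂ :=
  (q : ℂ) ^ (w + M) * ((∏ n ∈ (Finset.range N).erase M, (1 - (q : ℂ) ^ (w + n))) /
    (if M < N then 1 else 1 - (q : ℂ) ^ (w + M)))

theorem analyticAt_cpow_add (hq0 : 0 < q) (n w : ℂ) :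
    AnalyticAt ℂ (fun w => (q : ℂ) ^ (w + n)) w := by
  refine analyticAt_const.cpow (analyticAt_id.add analyticAt_const) ?_
  exact Complex.ofReal_mem_slitPlane.2 hq0

theorem one_sub_cpow_ne_zero (hq0 : 0 < q) (hq1 : q < 1) {w : ℂ} (hw : w.re ≠ 0) :
    1 - (q : ℂ) ^ w ≠ 0 := by
  intro h
  have h1 : ‖(q : ℂ) ^ w‖ = 1 := by rw [← sub_eq_zero.1 h, norm_one]
  rw [Complex.norm_cpow_eq_rpow_re_of_pos hq0, ← Real.rpow_zero q,
    Real.rpow_right_inj hq0 hq1.ne] at h1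
  exact hw h1

theorem re_of_eq_polarLattice {w : ℂ} {a : ℕ} {b : ℤ}
    (h : w = -(a : ℂ) + 2 * Real.pi * Complex.I / (Real.log q : ℂ) * (b : ℂ)) : w.re = -(a : ℝ) := by
  have h2 : 2 * (Real.pi : ℂ) * Complex.I / (Real.log q : ℂ) * (b : ℂ) =
      ((2 * Real.pi / Real.log q * b : ℝ) : ℂ) * Complex.I := by
    push_cast
    ring
  rw [h, h2, Complex.add_re, Complex.re_ofReal_mul, Complex.I_re]
  simp

theorem cpow_eq_one_of_eq_polarLattice (hq0 : 0 < q) (hq1 : q < 1) {w : ℂ} {a : ℕ} {b : ℤ}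
    (h : w = -(a : ℂ) + 2 * Real.pi * Complex.I / (Real.log q : ℂ) * (b : ℂ)) :
    (q : ℂ) ^ (w + a) = 1 := by
  have hlog : (Real.log q : ℂ) ≠ 0 := by exact_mod_cast (Real.log_neg hq0 hq1).ne
  rw [Complex.cpow_def_of_ne_zero (by exact_mod_cast hq0.ne'), ← Complex.ofReal_log hq0.le,
    Complex.exp_eq_one_iff]
  refine ⟨b, ?_⟩
  rw [h]
  field_simp
  ring

theorem mem_polarLattice_of_cpow_eq_one (hq0 : 0 < q) (hq1 : q < 1) {w : ℂ} {a : ℕ}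
    (h : (q : ℂ) ^ (w + a) = 1) : w ∈ polarLattice q := by
  have hlog : (Real.log q : ℂ) ≠ 0 := by exact_mod_cast (Real.log_neg hq0 hq1).ne
  rw [Complex.cpow_def_of_ne_zero (by exact_mod_cast hq0.ne'), ← Complex.ofReal_log hq0.le,
    Complex.exp_eq_one_iff] at h
  obtain ⟨b, hb⟩ := h
  refine ⟨a, b, ?_⟩
  field_simp
  linear_combination hb

theorem clearedFactor_eq (hq0 : 0 < q) (hq1 : q < 1) {N : ℕ} (M : ℕ) {w : ℂ} (hw : -(N : ℝ) < w.re)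
    (h : shiftedProd q N w ≠ 0) :
    (q : ℂ) ^ (w + M) / (1 - (q : ℂ) ^ (w + M)) = clearedFactor q N M w / shiftedProd q N w := by
  rw [div_eq_div_iff _ h, clearedFactor, mul_assoc]
  · congr 1
    split_ifs with hM
    · rw [div_one, shiftedProd, Finset.prod_erase_mul _ _ (Finset.mem_range.2 hM)]
    · rw [Finset.erase_eq_of_notMem (by simpa using hM), div_mul_cancel₀, shiftedProd]
      refine one_sub_cpow_ne_zero hq0 hq1 ?_
      have : (N : ℝ) ≤ M := by exact_mod_cast not_lt.1 hM
      rw [Complex.add_re, Complex.natCast_re]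
      linarith
  · by_cases hM : M < N
    · exact Finset.prod_ne_zero_iff.1 h M (Finset.mem_range.2 hM)
    · refine one_sub_cpow_ne_zero hq0 hq1 ?_
      have : (N : ℝ) ≤ M := by exact_mod_cast not_lt.1 hM
      rw [Complex.add_re, Complex.natCast_re]
      linarith

/-- The disc and the constant do not depend on M; the decay q^M is what makes the cleared series
converge normally. -/
theorem exists_clearedFactor_bound (hq0 : 0 < q) (hq1 : q < 1) (N : ℕ) {w₀ : ℂ}
    (hw₀ : -(N : ℝ) < w₀.re) :
    ∃ C > 0, ∃ ρ > 0, ∀ M, DifferentiableOn ℂ (clearedFactor q N M) (Metric.ball w₀ ρ) ∧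
      ∀ w ∈ Metric.ball w₀ ρ, ‖clearedFactor q N M w‖ ≤ C * q ^ M := by
  -- Half the distance from w₀ to the line Re w = -N: on the disc Re w + N > ρ, so for M ≥ N the
  -- denominator stays at least 1 - q^ρ in norm.
  set ρ : ℝ := (w₀.re + N) / 2 with hρ
  have hρ0 : 0 < ρ := by rw [hρ]; linarith
  have hball : ∀ w ∈ Metric.ball w₀ ρ, -(N : ℝ) + ρ < w.re := by
    intro w hw
    have h1 := (Complex.abs_re_le_norm (w - w₀)).trans_lt (mem_ball_iff_norm.1 hw)
    rw [Complex.sub_re, abs_lt] at h1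
    linarith [h1.1]
  have hqρ : q ^ ρ < 1 := Real.rpow_lt_one hq0.le hq1 hρ0
  have hpow : ∀ (n : ℕ), ∀ w ∈ Metric.ball w₀ ρ, ‖(q : ℂ) ^ (w + n)‖ ≤ q ^ (-(N : ℝ)) * q ^ n := by
    intro n w hw
    rw [Complex.norm_cpow_eq_rpow_re_of_pos hq0, Complex.add_re, Complex.natCast_re,
      Real.rpow_add hq0, Real.rpow_natCast]
    gcongr ?_ * _
    exact Real.rpow_le_rpow_of_exponent_ge hq0 hq1.le (by linarith [hball w hw])
  have hden : ∀ (M : ℕ), ∀ w ∈ Metric.ball w₀ ρ,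
      1 - q ^ ρ ≤ ‖if M < N then (1 : ℂ) else 1 - (q : ℂ) ^ (w + M)‖ := by
    intro M w hw
    split_ifs with hM
    · rw [norm_one]
      have := Real.rpow_pos_of_pos hq0 ρ
      linarith
    · have h1 : ‖(q : ℂ) ^ (w + M)‖ ≤ q ^ ρ := by
        rw [Complex.norm_cpow_eq_rpow_re_of_pos hq0]
        refine Real.rpow_le_rpow_of_exponent_ge hq0 hq1.le ?_
        have : (N : ℝ) ≤ M := by exact_mod_cast not_lt.1 hM
        rw [Complex.add_re, Complex.natCast_re]
        linarith [hball w hw]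
      have h2 := norm_sub_norm_le (1 : ℂ) ((q : ℂ) ^ (w + M))
      rw [norm_one] at h2
      linarith
  have hA : 1 ≤ 1 + q ^ (-(N : ℝ)) := by
    have := Real.rpow_pos_of_pos hq0 (-(N : ℝ))
    linarith
  refine ⟨q ^ (-(N : ℝ)) * ((1 + q ^ (-(N : ℝ))) ^ N / (1 - q ^ ρ)), ?_, ρ, hρ0, fun M => ⟨?_, ?_⟩⟩
  · have := sub_pos.2 hqρ
    positivity
  · intro w hw
    refine DifferentiableAt.differentiableWithinAt ?_
    have hc : ∀ n : ℕ, DifferentiableAt ℂ (fun w : ℂ => (q : ℂ) ^ (w + n)) w :=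
      fun n => (analyticAt_cpow_add hq0 n w).differentiableAt
    refine (hc M).mul (DifferentiableAt.div ?_ ?_ ?_)
    · exact DifferentiableAt.fun_finsetProd fun n _ => (hc n).const_sub 1
    · split_ifs
      · exact differentiableAt_const _
      · exact (hc M).const_sub 1
    · have := (sub_pos.2 hqρ).trans_le (hden M w hw)
      exact norm_pos_iff.1 this
  · intro w hw
    have hnum : ‖∏ n ∈ (Finset.range N).erase M, (1 - (q : ℂ) ^ (w + n))‖ ≤
        (1 + q ^ (-(N : ℝ))) ^ N := by
      rw [norm_prod]
      calc _ ≤ ∏ n ∈ (Finset.range N).erase M, (1 + q ^ (-(N : ℝ))) := by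
            refine Finset.prod_le_prod (fun _ _ => norm_nonneg _) fun n _ => ?_
            refine (norm_sub_le _ _).trans ?_
            rw [norm_one]
            gcongr
            refine (hpow n w hw).trans (mul_le_of_le_one_right (by positivity) ?_)
            exact pow_le_one₀ hq0.le hq1.le
        _ = (1 + q ^ (-(N : ℝ))) ^ ((Finset.range N).erase M).card := by rw [Finset.prod_const]
        _ ≤ _ := by
            refine pow_le_pow_right₀ hA ?_
            simpa using Finset.card_le_card (Finset.erase_subset M (Finset.range N))
    rw [clearedFactor, norm_mul, norm_div]
    calc _ ≤ q ^ (-(N : ℝ)) * q ^ M * ((1 + q ^ (-(N : ℝ))) ^ N / (1 - q ^ ρ)) := by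
          have := sub_pos.2 hqρ
          gcongr
          · exact hpow M w hw
          · exact hden M w hw
      _ = _ := by ring

/-- Near any point, `shiftedProd` is a unit times the linear factor of its simple zero, if any. -/
theorem exists_shiftedProd_factorization (hq0 : 0 < q) (hq1 : q < 1) {N : ℕ} {w₀ : ℂ}
    (hw₀ : -(N : ℝ) < w₀.re) [Decidable (w₀ ∈ polarLattice q)] :
    ∃ v : ℂ → ℂ, AnalyticAt ℂ v w₀ ∧ v w₀ ≠ 0 ∧
      ∀ w, shiftedProd q N w = (if w₀ ∈ polarLattice q then w - w₀ else 1) * v w := by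
  have hlog : (Real.log q : ℂ) ≠ 0 := by exact_mod_cast (Real.log_neg hq0 hq1).ne
  have hA : ∀ n : ℕ, AnalyticAt ℂ (fun w : ℂ => 1 - (q : ℂ) ^ (w + n)) w₀ :=
    fun n => analyticAt_const.sub (analyticAt_cpow_add hq0 n w₀)
  split_ifs with hw
  · obtain ⟨a, b, hab⟩ := id hw
    have haN : a < N := by
      rw [re_of_eq_polarLattice hab] at hw₀
      exact_mod_cast neg_lt_neg_iff.1 hw₀
    have hone : (q : ℂ) ^ (w₀ + a) = 1 := cpow_eq_one_of_eq_polarLattice hq0 hq1 hab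
    set f : ℂ → ℂ := fun w => 1 - (q : ℂ) ^ (w + a) with hf
    have hf0 : f w₀ = 0 := by rw [hf]; simp only [hone, sub_self]
    have hderiv : deriv f w₀ ≠ 0 := by
      have h1 : HasDerivAt (fun w : ℂ => (q : ℂ) ^ (w + a))
          ((q : ℂ) ^ (w₀ + a) * Complex.log q * 1) w₀ :=
        ((hasDerivAt_id w₀).add_const (a : ℂ)).const_cpow (Or.inl (by exact_mod_cast hq0.ne'))
      rw [(h1.const_sub 1).deriv, hone, ← Complex.ofReal_log hq0.le]
      simpa using hlog
    -- Only the factor n = a vanishes at w₀, and simply; `dslope` divides out its zero.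
    refine ⟨fun w => dslope f w₀ w * ∏ n ∈ (Finset.range N).erase a, (1 - (q : ℂ) ^ (w + n)),
      ?_, ?_, fun w => ?_⟩
    · refine AnalyticAt.mul ?_ (Finset.analyticAt_fun_prod _ fun n _ => hA n)
      obtain ⟨P, hP⟩ := hA a
      exact hP.has_fpower_series_dslope_fslope.analyticAt
    · simp only [dslope_same]
      refine mul_ne_zero hderiv (Finset.prod_ne_zero_iff.2 fun n hn => ?_)
      refine one_sub_cpow_ne_zero hq0 hq1 ?_
      rw [Complex.add_re, re_of_eq_polarLattice hab, Complex.natCast_re]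
      have : (n : ℝ) ≠ a := by exact_mod_cast (Finset.mem_erase.1 hn).1
      intro h
      exact this (by linarith)
    · have h1 := sub_smul_dslope f w₀ w
      rw [hf0, sub_zero, smul_eq_mul] at h1
      rw [← mul_assoc, h1, shiftedProd, Finset.mul_prod_erase (Finset.range N)
        (fun n : ℕ => 1 - (q : ℂ) ^ (w + n)) (Finset.mem_range.2 haN)]
  · refine ⟨shiftedProd q N, Finset.analyticAt_fun_prod _ fun n _ => hA n, ?_, fun w => ?_⟩
    · refine Finset.prod_ne_zero_iff.2 fun n _ h => hw ?_
      exact mem_polarLattice_of_cpow_eq_one hq0 hq1 (sub_eq_zero.1 h).symm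
    · rw [one_mul]

end PoleFactor

/-! ### The cleared expansion -/

section Cleared

variable {q : ℝ} {r : ℕ}

/-- The partial sum as a continuous linear form. -/
noncomputable def partialSumCLM (r : ℕ) (j : Fin r) : (Fin r → ℂ) →L[ℂ] ℂ :=
  ∑ i ∈ Finset.Iic j, ContinuousLinearMap.proj i

theorem partialSumCLM_apply (j : Fin r) (s : Fin r → ℂ) : partialSumCLM r j s = partialSum s j := by
  simp [partialSumCLM, partialSum]

theorem analyticAt_partialSum (j : Fin r) (p : Fin r → ℂ) :
    AnalyticAt ℂ (fun s => partialSum s j) p := by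
  exact ((partialSumCLM r j).analyticAt p).congr
    (Eventually.of_forall (partialSumCLM_apply j))

/-- The expansion with its poles in `Re (s_1 + ⋯ + s_j) > -N` cleared. -/
noncomputable def clearedExpansion (q : ℝ) (N : ℕ) {r : ℕ} (s : Fin r → ℂ) : ℂ :=
  ((1 - q : ℝ) : ℂ) ^ (∑ i, s i) * ∑' m : Fin r → ℕ, (∏ i, risingCoeff (m i) (s i)) *
    ∏ j, clearedFactor q N (∑ i ∈ Finset.Iic j, m i) (partialSum s j)

/-- The product of the `shiftedProd`s clearing the poles. -/
noncomputable def clearingFactor (q : ℝ) (N : ℕ) {r : ℕ} (s : Fin r → ℂ) : ℂ :=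
  ∏ j, shiftedProd q N (partialSum s j)

theorem qZetaExpansion_eq_div (hq0 : 0 < q) (hq1 : q < 1) {N : ℕ} {s : Fin r → ℂ}
    (hs : ∀ j, -(N : ℝ) < (partialSum s j).re) (h : clearingFactor q N s ≠ 0) :
    qZetaExpansion q s = clearedExpansion q N s / clearingFactor q N s := by
  rw [qZetaExpansion, clearedExpansion, mul_div_assoc]
  congr 1
  rw [← tsum_div_const]
  refine tsum_congr fun m => ?_
  rw [mul_div_assoc, clearingFactor, ← Finset.prod_div_distrib]
  congr 1
  refine Finset.prod_congr rfl fun j _ => ?_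
  exact clearedFactor_eq hq0 hq1 _ (hs j) (Finset.prod_ne_zero_iff.1 h j (Finset.mem_univ j))

theorem analyticAt_clearedExpansion (hq0 : 0 < q) (hq1 : q < 1) {N : ℕ} {p : Fin r → ℂ}
    (hp : ∀ j, -(N : ℝ) < (partialSum p j).re) : AnalyticAt ℂ (clearedExpansion q N) p := by
  have hpre : AnalyticAt ℂ (fun s : Fin r → ℂ => ((1 - q : ℝ) : ℂ) ^ (∑ i, s i)) p := by
    refine analyticAt_const.cpow ?_ (Complex.ofReal_mem_slitPlane.2 (by linarith))
    exact Finset.analyticAt_fun_sum _ fun i _ =>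
      (ContinuousLinearMap.proj (R := ℂ) (φ := fun _ : Fin r => ℂ) i).analyticAt p
  choose C hC ρ hρ hbd using fun j => exists_clearedFactor_bound hq0 hq1 N (hp j)
  -- Each term is a product of 2r one-variable functions: binomial coefficients in the coordinates
  -- and cleared factors in the partial sums.
  let g : Fin r ⊕ Fin r → (Fin r → ℕ) → ℂ → ℂ := Sum.elim
    (fun i m => risingCoeff (m i)) (fun j m => clearedFactor q N (∑ i ∈ Finset.Iic j, m i))
  let b : Fin r ⊕ Fin r → (Fin r → ℕ) → ℝ := Sum.elim
    (fun i m => risingCoeff (m i) (‖p i‖ + 1)) (fun j m => C j * q ^ (∑ i ∈ Finset.Iic j, m i))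
  let L : Fin r ⊕ Fin r → (Fin r → ℂ) →L[ℂ] ℂ := Sum.elim
    (fun i => ContinuousLinearMap.proj i) (fun j => partialSumCLM r j)
  have hb0 : ∀ k α, 0 < b k α := by
    rintro (i | j) m
    · exact risingCoeff_pos _ (by positivity)
    · exact mul_pos (hC j) (by positivity)
  have hmain : AnalyticAt ℂ (fun z => ∑' α, ∏ k, g k α (L k z)) p := by
    refine analyticAt_tsum_prod_comp g b L p hb0 ?_ ?_
    · have hA : Summable fun m : Fin r → ℕ => ‖∏ i, risingCoeff (m i) (‖p i‖ + 1) * q ^ m i‖ :=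
        (summable_norm_prod_and_tsum_prod r (fun i m => risingCoeff m (‖p i‖ + 1) * q ^ m)
          (fun i => (summable_risingCoeff (‖p i‖ + 1) hq0.le hq1).norm)).1
      refine Summable.of_nonneg_of_le (fun m => Finset.prod_nonneg fun k _ => (hb0 k m).le)
        (fun m => ?_) (hA.mul_left (∏ j, C j))
      rw [Fintype.prod_sum_type]
      simp only [b, Sum.elim_inl, Sum.elim_inr]
      have hnn : ∀ i, 0 < risingCoeff (m i) (‖p i‖ + 1) := fun i =>
        risingCoeff_pos _ (by positivity)
      rw [Real.norm_of_nonneg (Finset.prod_nonneg fun i _ =>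
        (mul_pos (hnn i) (pow_pos hq0 _)).le), Finset.prod_mul_distrib, Finset.prod_mul_distrib,
        mul_left_comm]
      refine mul_le_mul_of_nonneg_left (mul_le_mul_of_nonneg_left ?_ ?_) ?_
      -- M_j ≥ m_j, so q^{M_j} ≤ q^{m_j}, enough to sum the binomial coefficients.
      · refine Finset.prod_le_prod (fun _ _ => by positivity) fun j _ => ?_
        exact pow_le_pow_of_le_one hq0.le hq1.le
          (Finset.single_le_sum (f := m) (by simp) (Finset.mem_Iic.2 le_rfl))
      · exact Finset.prod_nonneg fun i _ => (hnn i).le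
      · exact Finset.prod_nonneg fun j _ => (hC j).le
    · rintro (i | j)
      · refine ⟨1, one_pos, fun m => ⟨?_, fun z hz => ?_⟩⟩
        · refine Differentiable.differentiableOn ?_
          simp only [g, Sum.elim_inl]
          unfold risingCoeff
          fun_prop
        · refine norm_risingCoeff_le _ ?_
          have h1 : ‖z - p i‖ < 1 := mem_ball_iff_norm.1 hz
          have h2 := norm_le_norm_add_norm_sub' z (p i)
          linarith
      · refine ⟨ρ j, hρ j, fun m => ?_⟩
        have := hbd j (∑ i ∈ Finset.Iic j, m i)
        rwa [← partialSumCLM_apply] at this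
  refine (hpre.mul hmain).congr (Eventually.of_forall fun s => ?_)
  simp only [clearedExpansion, Pi.mul_apply]
  congr 1
  refine tsum_congr fun m => ?_
  rw [Fintype.prod_sum_type]
  simp [g, L, partialSumCLM_apply]

end Cleared

/-! ### Location and order of the poles -/

section Main

variable {q : ℝ} {r : ℕ}

theorem not_eventually_partialSum_sub_eq_zero (p : Fin r → ℂ) (j : Fin r) :
    ¬ ∀ᶠ z in 𝓝 p, partialSum z j - partialSum p j = 0 := by
  intro h
  have hc : Tendsto (fun t : ℂ => p + Pi.single j t) (𝓝 0) (𝓝 p) := by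
    have : Continuous fun t : ℂ => p + Pi.single j t :=
      continuous_const.add (continuous_single (A := fun _ : Fin r => ℂ) j)
    simpa using this.tendsto 0
  have h' : ∀ᶠ t : ℂ in 𝓝[≠] 0, t = 0 := by
    refine ((hc.eventually h).mono fun t ht => ?_).filter_mono nhdsWithin_le_nhds
    simpa [partialSum, Finset.sum_add_distrib, Finset.sum_pi_single] using ht
  obtain ⟨t, ht, ht'⟩ := (h'.and self_mem_nhdsWithin).exists
  exact ht' ht

theorem exists_nat_neg_lt_re (p : Fin r → ℂ) :
    ∃ N : ℕ, 1 ≤ N ∧ ∀ j, -(N : ℝ) < (partialSum p j).re := by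
  obtain ⟨N, hN⟩ := exists_nat_gt (∑ j, |(partialSum p j).re|)
  -- The extra 1 makes the bound positive, so that points with some partial sums equal to 0 also lie
  -- in the half-spaces.
  refine ⟨N + 1, by simp, fun j => ?_⟩
  have h1 := Finset.single_le_sum (f := fun j => |(partialSum p j).re|)
    (fun _ _ => abs_nonneg _) (Finset.mem_univ j)
  have h2 := neg_abs_le (partialSum p j).re
  push_cast
  linarith

/-- The clearing factor is a unit times the linear factors of the polar hyperplanes through `p`. -/
theorem exists_clearingFactor_factorization (hq0 : 0 < q) (hq1 : q < 1) {N : ℕ} {p : Fin r → ℂ}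
    (hp : ∀ j, -(N : ℝ) < (partialSum p j).re) :
    ∃ V : (Fin r → ℂ) → ℂ, AnalyticAt ℂ V p ∧ V p ≠ 0 ∧
      ∀ s, clearingFactor q N s =
        (∏ j ∈ polarIndices q p, (partialSum s j - partialSum p j)) * V s := by
  classical
  choose v hv hv0 hvw using fun j => exists_shiftedProd_factorization hq0 hq1 (hp j)
  refine ⟨fun s => ∏ j, v j (partialSum s j), ?_, ?_, fun s => ?_⟩
  · exact Finset.analyticAt_fun_prod _ fun j _ =>
      AnalyticAt.fun_comp (hv j) (analyticAt_partialSum j p)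
  · exact Finset.prod_ne_zero_iff.2 fun j _ => hv0 j
  · rw [clearingFactor, polarIndices, Finset.prod_filter, ← Finset.prod_mul_distrib]
    refine Finset.prod_congr rfl fun j _ => ?_
    rw [hvw j]

theorem analyticAt_prod_partialSum_sub (J : Finset (Fin r)) (p z : Fin r → ℂ) :
    AnalyticAt ℂ (fun s => ∏ j ∈ J, (partialSum s j - partialSum p j)) z :=
  Finset.analyticAt_fun_prod _ fun j _ => (analyticAt_partialSum j z).sub analyticAt_const

theorem analyticAt_clearingFactor (hq0 : 0 < q) (hq1 : q < 1) {N : ℕ} {p : Fin r → ℂ}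
    (hp : ∀ j, -(N : ℝ) < (partialSum p j).re) :
    AnalyticAt ℂ (clearingFactor q N) p ∧ ¬ ∀ᶠ z in 𝓝 p, clearingFactor q N z = 0 := by
  obtain ⟨V, hV, hV0, h⟩ := exists_clearingFactor_factorization hq0 hq1 hp
  have he : clearingFactor q N =
      fun s => (∏ j ∈ polarIndices q p, (partialSum s j - partialSum p j)) * V s := funext h
  rw [he]
  have h1 := analyticAt_prod_partialSum_sub (polarIndices q p) p p
  refine ⟨h1.mul hV, h1.not_eventually_mul_eq_zero hV ?_ fun h0 => hV0 h0.self_of_nhds⟩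
  exact not_eventually_prod_eq_zero _
    (fun j _ => (analyticAt_partialSum j p).sub analyticAt_const)
    fun j _ => not_eventually_partialSum_sub_eq_zero p j

theorem eventually_neg_lt_re_partialSum {N : ℕ} {p : Fin r → ℂ}
    (hp : ∀ j, -(N : ℝ) < (partialSum p j).re) :
    ∀ᶠ z in 𝓝 p, ∀ j, -(N : ℝ) < (partialSum z j).re := by
  rw [eventually_all]
  intro j
  have hc : ContinuousAt (fun z => (partialSum z j).re) p :=
    Complex.continuous_re.continuousAt.comp (analyticAt_partialSum j p).continuousAt
  exact hc.eventually_const_lt (hp j)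

theorem isMeromorphicAt_qZetaExpansion (hq0 : 0 < q) (hq1 : q < 1) (p : Fin r → ℂ) :
    IsMeromorphicAt (qZetaExpansion q) p := by
  obtain ⟨N, -, hp⟩ := exists_nat_neg_lt_re p
  obtain ⟨h1, h2⟩ := analyticAt_clearingFactor hq0 hq1 hp
  exact ⟨_, _, analyticAt_clearedExpansion hq0 hq1 hp, h1, h2,
    (eventually_neg_lt_re_partialSum hp).mono fun z hz h => qZetaExpansion_eq_div hq0 hq1 hz h⟩

theorem isQZetaContinuation_qZetaExpansion (hq0 : 0 < q) (hq1 : q < 1) :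
    IsQZetaContinuation q (qZetaExpansion q : (Fin r → ℂ) → ℂ) :=
  ⟨isMeromorphicAt_qZetaExpansion hq0 hq1, fun _ hs => (qZetaSeries_eq_expansion hq0 hq1 hs).symm⟩

theorem isRegularAt_prod_mul_qZetaExpansion (hq0 : 0 < q) (hq1 : q < 1) (p : Fin r → ℂ) :
    IsRegularAt (fun s => (∏ j ∈ polarIndices q p, (partialSum s j - partialSum p j)) *
      qZetaExpansion q s) p := by
  obtain ⟨N, -, hp⟩ := exists_nat_neg_lt_re p
  obtain ⟨h1, h2⟩ := analyticAt_clearingFactor hq0 hq1 hp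
  obtain ⟨V, hV, hV0, h⟩ := exists_clearingFactor_factorization hq0 hq1 hp
  refine ⟨fun s => clearedExpansion q N s / V s, clearingFactor q N,
    (analyticAt_clearedExpansion hq0 hq1 hp).div hV hV0, h1, h2, ?_⟩
  filter_upwards [eventually_neg_lt_re_partialSum hp] with z hz hne
  rw [qZetaExpansion_eq_div hq0 hq1 hz hne]
  rw [h z] at hne ⊢
  have e1 := left_ne_zero_of_mul hne
  have e2 := right_ne_zero_of_mul hne
  field_simp

/-- The product has exactly one vanishing factor at w, namely n = a, and it is removed only when M =
a. -/
theorem clearedFactor_ne_zero_iff (hq0 : 0 < q) (hq1 : q < 1) {N a : ℕ} (haN : a < N) (M : ℕ)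
    {w : ℂ} {b : ℤ}
    (h : w = -(a : ℂ) + 2 * Real.pi * Complex.I / (Real.log q : ℂ) * (b : ℂ)) :
    clearedFactor q N M w ≠ 0 ↔ M = a := by
  have hq : (q : ℂ) ≠ 0 := by exact_mod_cast hq0.ne'
  have hone := cpow_eq_one_of_eq_polarLattice hq0 hq1 h
  constructor
  · intro hne
    by_contra hM
    refine hne ?_
    rw [clearedFactor, Finset.prod_eq_zero (i := a), zero_div, mul_zero]
    · exact Finset.mem_erase.2 ⟨Ne.symm hM, Finset.mem_range.2 haN⟩
    · rw [hone, sub_self]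
  · rintro rfl
    rw [clearedFactor, if_pos haN, div_one]
    refine mul_ne_zero ((Complex.cpow_ne_zero_iff).2 (Or.inl hq))
      (Finset.prod_ne_zero_iff.2 fun n hn => one_sub_cpow_ne_zero hq0 hq1 ?_)
    rw [Complex.add_re, re_of_eq_polarLattice h, Complex.natCast_re]
    have : (n : ℝ) ≠ M := by exact_mod_cast (Finset.mem_erase.1 hn).1
    intro h
    exact this (by linarith)

theorem partialSum_single (i j : Fin r) (w : ℂ) :
    partialSum (Pi.single i w) j = if i ≤ j then w else 0 := by
  simp [partialSum]

theorem risingCoeff_polarLattice_ne_zero {w : ℂ} {a : ℕ} {b : ℤ}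
    (h : w = -(a : ℂ) + 2 * Real.pi * Complex.I / (Real.log q : ℂ) * (b : ℂ)) :
    risingCoeff a w ≠ 0 := by
  refine Finset.prod_ne_zero_iff.2 fun t ht => div_ne_zero (fun h0 => ?_) ?_
  · have h1 := congrArg Complex.re h0
    rw [Complex.add_re, re_of_eq_polarLattice h, Complex.natCast_re, Complex.zero_re] at h1
    have : (t : ℝ) < a := by exact_mod_cast Finset.mem_range.1 ht
    linarith
  · exact_mod_cast t.succ_ne_zero

/-- The partial sums of w·e_i are 0 before i and w from i on, so a nonzero term needs M_j = 0 and
M_j = a respectively, which forces m = a·e_i. Its binomial coefficient is nonzero because Re (w + t)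
= t - a < 0 for t < a. -/
theorem clearedExpansion_single_ne_zero (hq0 : 0 < q) (hq1 : q < 1) {N a : ℕ} (haN : a < N)
    (i : Fin r) {w : ℂ} {b : ℤ}
    (h : w = -(a : ℂ) + 2 * Real.pi * Complex.I / (Real.log q : ℂ) * (b : ℂ)) :
    clearedExpansion q N (Pi.single i w : Fin r → ℂ) ≠ 0 := by
  have h1q : ((1 - q : ℝ) : ℂ) ≠ 0 := by exact_mod_cast (sub_pos.2 hq1).ne'
  have hzero : (0 : ℂ) =
      -((0 : ℕ) : ℂ) + 2 * Real.pi * Complex.I / (Real.log q : ℂ) * ((0 : ℤ) : ℂ) := by simp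
  have hsum : ∀ j, ∑ l ∈ Finset.Iic j, (Pi.single i a : Fin r → ℕ) l = if i ≤ j then a else 0 := by
    intro j
    simp
  have hiff : ∀ (m : Fin r → ℕ) j, clearedFactor q N (∑ l ∈ Finset.Iic j, m l)
      (partialSum (Pi.single i w) j) ≠ 0 ↔
      ∑ l ∈ Finset.Iic j, m l = ∑ l ∈ Finset.Iic j, (Pi.single i a : Fin r → ℕ) l := by
    intro m j
    rw [partialSum_single, hsum]
    split_ifs
    · exact clearedFactor_ne_zero_iff hq0 hq1 haN _ h
    · exact clearedFactor_ne_zero_iff hq0 hq1 (Nat.zero_lt_of_lt haN) _ hzero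
  rw [clearedExpansion]
  refine mul_ne_zero ((Complex.cpow_ne_zero_iff).2 (Or.inl h1q)) ?_
  rw [tsum_eq_single (Pi.single i a)]
  · refine mul_ne_zero (Finset.prod_ne_zero_iff.2 fun l _ => ?_)
      (Finset.prod_ne_zero_iff.2 fun j _ => (hiff _ j).2 rfl)
    by_cases hl : l = i
    · subst hl
      simpa using risingCoeff_polarLattice_ne_zero h
    · simp [hl, risingCoeff]
  · intro m hm
    by_contra hne
    refine hm (eq_of_sum_Iic_eq fun j => (hiff m j).1 ?_)
    exact Finset.prod_ne_zero_iff.1 (right_ne_zero_of_mul hne) j (Finset.mem_univ j)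

theorem partialSum_add_smul (p d : Fin r → ℂ) (t : ℂ) (j : Fin r) :
    partialSum (p + t • d) j = partialSum p j + t * partialSum d j := by
  simp [partialSum, Finset.sum_add_distrib, Finset.mul_sum]

theorem partialSum_sub (p d : Fin r → ℂ) (j : Fin r) :
    partialSum (p - d) j = partialSum p j - partialSum d j := by
  simp [partialSum]

/-- If the cleared expansion vanishes near `p` on a polar hyperplane, it vanishes on all of the
hyperplane within its half-space of definition. -/
theorem clearedExpansion_eq_zero_of_eventually (hq0 : 0 < q) (hq1 : q < 1) {N : ℕ}
    {p P : Fin r → ℂ} (hp : ∀ j, -(N : ℝ) < (partialSum p j).re)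
    (hP : ∀ j, -(N : ℝ) < (partialSum P j).re) {i : Fin r} (hi : partialSum P i = partialSum p i)
    (h : ∀ᶠ z in 𝓝 p, partialSum z i = partialSum p i → clearedExpansion q N z = 0) :
    clearedExpansion q N P = 0 := by
  -- The parameters for which the complex line through p and P stays in the half-spaces. This set is
  -- convex and contains 0 and 1, and the line lies in the hyperplane.
  let T : Set ℂ := {t | ∀ j, -(N : ℝ) < (partialSum (p + t • (P - p)) j).re}
  have hT : Convex ℝ T := by
    intro x hx y hy α β hα hβ hαβ j
    have hx' := hx j
    have hy' := hy j
    rw [partialSum_add_smul, Complex.add_re] at hx' hy' ⊢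
    have e : (((α • x + β • y) * partialSum (P - p) j)).re =
        α * (x * partialSum (P - p) j).re + β * (y * partialSum (P - p) j).re := by
      rw [add_mul, Complex.add_re, smul_mul_assoc, smul_mul_assoc, Complex.smul_re, Complex.smul_re]
      rfl
    rw [e]
    have e2 : (partialSum p j).re = (α + β) * (partialSum p j).re := by rw [hαβ, one_mul]
    have e3 : (N : ℝ) = (α + β) * N := by rw [hαβ, one_mul]
    rw [e2, e3]
    rcases hα.eq_or_lt with rfl | hα'
    · rw [zero_add] at hαβ
      subst hαβ
      linarith
    · nlinarith [mul_lt_mul_of_pos_left hx' hα', mul_le_mul_of_nonneg_left hy'.le hβ]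
  have hline : ∀ t, AnalyticAt ℂ (fun t : ℂ => p + t • (P - p)) t := fun t =>
    analyticAt_const.add (analyticAt_id.smul analyticAt_const)
  have hA : AnalyticOnNhd ℂ (fun t : ℂ => clearedExpansion q N (p + t • (P - p))) T :=
    fun t ht => AnalyticAt.fun_comp (analyticAt_clearedExpansion hq0 hq1 ht) (hline t)
  have h0 : (0 : ℂ) ∈ T := fun j => by simpa using hp j
  have h1 : (1 : ℂ) ∈ T := fun j => by simpa using hP j
  have hev : ∀ᶠ t : ℂ in 𝓝 0, clearedExpansion q N (p + t • (P - p)) = 0 := by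
    have hc : Tendsto (fun t : ℂ => p + t • (P - p)) (𝓝 0) (𝓝 p) := by
      simpa using (hline 0).continuousAt.tendsto
    filter_upwards [hc.eventually h] with t ht
    refine ht ?_
    rw [partialSum_add_smul, partialSum_sub, hi, sub_self, mul_zero, add_zero]
  have := hA.eqOn_zero_of_preconnected_of_eventuallyEq_zero hT.isPreconnected h0 hev h1
  simpa using this

theorem not_isRegularAt_prod_erase_mul_qZetaExpansion (hq0 : 0 < q) (hq1 : q < 1) (p : Fin r → ℂ)
    {i : Fin r} (hi : i ∈ polarIndices q p) :
    ¬ IsRegularAt (fun s => (∏ j ∈ (polarIndices q p).erase i, (partialSum s j - partialSum p j)) *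
      qZetaExpansion q s) p := by
  classical
  rintro ⟨φ, h, hφ, hh, hh0, heq⟩
  obtain ⟨N, hN, hp⟩ := exists_nat_neg_lt_re p
  obtain ⟨hD, hD0⟩ := analyticAt_clearingFactor hq0 hq1 hp
  obtain ⟨V, hV, -, hfac⟩ := exists_clearingFactor_factorization hq0 hq1 hp
  have hG := analyticAt_clearedExpansion hq0 hq1 hp
  have hl := analyticAt_partialSum i p
  -- Regularity without the i-th factor makes the cleared expansion divisible by the i-th linear
  -- form; the identity holds off a proper zero set, hence everywhere near p.
  have hdiv : ∀ᶠ z in 𝓝 p,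
      clearedExpansion q N z - φ z * V z * (partialSum z i - partialSum p i) = 0 := by
    refine AnalyticAt.eventually_eq_zero_of_mul (g := fun z => h z * clearingFactor q N z)
      (hG.sub ((hφ.mul hV).mul (hl.sub analyticAt_const))) (hh.mul hD) ?_
      (hh.not_eventually_mul_eq_zero hD hh0 hD0)
    filter_upwards [heq, eventually_neg_lt_re_partialSum hp] with z hz hre
    by_cases c0 : h z = 0
    · simp [c0]
    by_cases c1 : clearingFactor q N z = 0
    · simp [c1]
    have e := hz c0
    have e2 := qZetaExpansion_eq_div hq0 hq1 hre c1
    rw [eq_div_iff c1] at e2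
    rw [hfac z, ← Finset.mul_prod_erase _ _ hi] at e2
    have e3 : clearedExpansion q N z - φ z * V z * (partialSum z i - partialSum p i) = 0 := by
      rw [← e, ← e2]
      ring
    rw [e3, zero_mul]
  obtain ⟨a, b, hab⟩ : partialSum p i ∈ polarLattice q := by
    simpa [polarIndices] using hi
  have haN : a < N := by
    have := hp i
    rw [re_of_eq_polarLattice hab] at this
    exact_mod_cast neg_lt_neg_iff.1 this
  refine clearedExpansion_single_ne_zero hq0 hq1 haN i hab
    (clearedExpansion_eq_zero_of_eventually hq0 hq1 hp (fun j => ?_) (i := i) ?_ ?_)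
  · rw [partialSum_single]
    split_ifs
    · exact hp i
    · have : (0 : ℝ) < N := by exact_mod_cast hN
      simpa using this
  · rw [partialSum_single, if_pos le_rfl]
  · filter_upwards [hdiv] with z hz hzi
    rw [hzi, sub_self, mul_zero, sub_zero] at hz
    exact hz

theorem isOpen_convergenceDomain (r : ℕ) : IsOpen (convergenceDomain r) := by
  have h : convergenceDomain r = ⋂ j, {s | 0 < (partialSum s j).re} := by
    ext s
    simp [convergenceDomain]
  rw [h]
  refine isOpen_iInter_of_finite fun j => isOpen_lt continuous_const ?_
  exact Complex.continuous_re.comp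
    (continuous_iff_continuousAt.2 fun p => (analyticAt_partialSum j p).continuousAt)

theorem one_mem_convergenceDomain (r : ℕ) : (1 : Fin r → ℂ) ∈ convergenceDomain r := by
  intro j
  simp [partialSum]
  positivity

theorem IsQZetaContinuation.agreeGenericallyAt {F G : (Fin r → ℂ) → ℂ}
    (hF : IsQZetaContinuation q F) (hG : IsQZetaContinuation q G) (p : Fin r → ℂ) :
    AgreeGenericallyAt F G p := by
  refine agreeGenericallyAt_of_isMeromorphicAt hF.meromorphic hG.meromorphic (p₀ := 1)
    ⟨fun _ => 1, analyticAt_const, by simp [NeBot.ne], ?_⟩ p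
  filter_upwards [(isOpen_convergenceDomain r).mem_nhds (one_mem_convergenceDomain r)] with z hz _
  rw [hF.eq_series z hz, hG.eq_series z hz]

theorem IsQZetaContinuation.hasSimplePolesAlong (hq0 : 0 < q) (hq1 : q < 1)
    {F : (Fin r → ℂ) → ℂ} (hF : IsQZetaContinuation q F) (p : Fin r → ℂ) :
    HasSimplePolesAlong F p (polarIndices q p) := by
  have hagree := hF.agreeGenericallyAt (isQZetaContinuation_qZetaExpansion hq0 hq1) p
  refine ⟨(hagree.mul_left _).isRegularAt (isRegularAt_prod_mul_qZetaExpansion hq0 hq1 p),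
    fun i hi hreg => not_isRegularAt_prod_erase_mul_qZetaExpansion hq0 hq1 p hi ?_⟩
  exact (hagree.symm.mul_left _).isRegularAt hreg

theorem IsRegularAt.mul_left {A F : (Fin r → ℂ) → ℂ} {p : Fin r → ℂ} (hA : AnalyticAt ℂ A p)
    (hF : IsRegularAt F p) : IsRegularAt (fun s => A s * F s) p := by
  obtain ⟨φ, h, h1, h2, h3, h4⟩ := hF
  exact ⟨fun s => A s * φ s, h, hA.mul h1, h2, h3, h4.mono fun z hz hne => by simp only [hz hne]⟩

theorem HasSimplePolesAlong.isRegularAt_iff {F : (Fin r → ℂ) → ℂ} {p : Fin r → ℂ}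
    {J : Finset (Fin r)} (h : HasSimplePolesAlong F p J) : IsRegularAt F p ↔ J = ∅ := by
  constructor
  · intro hreg
    by_contra hne
    obtain ⟨i, hi⟩ := Finset.nonempty_iff_ne_empty.2 hne
    exact h.2 i hi (hreg.mul_left (analyticAt_prod_partialSum_sub _ p p))
  · rintro rfl
    simpa using h.1

end Main

theorem mainTheorem3 (q : ℝ) (hq0 : 0 < q) (hq1 : q < 1) (r : ℕ) (hr : 1 ≤ r) :
    (∀ s ∈ convergenceDomain r, Summable fun k : DecreasingTuple r => qZetaTerm q s k) ∧
    (∃ F : (Fin r → ℂ) → ℂ, IsQZetaContinuation q F) ∧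
    ∀ F : (Fin r → ℂ) → ℂ, IsQZetaContinuation q F →
      {p : Fin r → ℂ | IsPoleAt F p} = {p | ∃ j, partialSum p j ∈ polarLattice q} ∧
      ∀ p : Fin r → ℂ, HasSimplePolesAlong F p (polarIndices q p) := by
  refine ⟨fun s hs => summable_qZetaTerm hq0 hq1 hs,
    ⟨_, isQZetaContinuation_qZetaExpansion hq0 hq1⟩, fun F hF => ⟨?_, fun p => ?_⟩⟩
  · ext p
    have h := (hF.hasSimplePolesAlong hq0 hq1 p).isRegularAt_iff
    rw [Set.mem_ofPred_eq, IsPoleAt, h, and_iff_right (hF.meromorphic p)]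
    simp [polarIndices, Finset.filter_eq_empty_iff]
  · exact hF.hasSimplePolesAlong hq0 hq1 p
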